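/- Rings are commutative with $1$. A $\lambda$-structure on a ring $A$ is a family of ring endomorphisms $\Psi^n$ ($n\ge 1$) with $\Psi^1=\mathrm{id}$, $\Psi^{mn}=\Psi^m\circ\Psi^n$, such that for every prime $p$ the map $\Psi^p$ lifts the Frobenius of $A/pA$. A $\lambda$-morphism is a ring morphism commuting with all $\Psi^n$, and a $\lambda$-ideal is an ideal $I$ with $\Psi^n(I)\subseteq I$ for all $n\ge 1$, so that $A/I$ inherits the $\lambda$-structure. For a ring $R$ let $w(R)=1+tR[[t]]$, with addition $\oplus$ the multiplication of power series, multiplication $\otimes$ determined functorially by $\frac1{1-at}\otimes\frac1{1-bt}=\frac1{1-abt}$, $\lambda$-structure determined functorially by $\Psi^n\bigl(\frac1{1-at}\bigr)=\frac1{1-a^nt}$, and Verschiebung operators $V_n(s(t))=s(t^n)$, $n\ge 1$. Then for every ring $R$: (0) $\Psi^n\circ V_n=[n]$ (multiplication by $n$) on $w(R)$ for all $n\ge1$. Let $I$ be a $\lambda$-ideal of $w(R)$ such that $A=w(R)/I$ has no additive torsion; let $\pi:w(R)\to A$ be the projection and $v_n=\pi\circ V_n:w(R)\to A$. Then: (1)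 for every prime $p$, if $d:w(R)\to w(R)$ is a map with $s^{\otimes p}\oplus[p]\,d(s)=\Psi^p(s)$ for all $s$, then $d(I)\subseteq I$; (2) the Verschiebung operators survive in $A$ in the sense that the additive maps $v_n$ satisfy $\ker(v_n)\subseteq I$ for all $n\ge 1$; moreover $\Psi^n\circ v_n=n\pi$, $\Psi^m\circ v_n=v_n\circ\Psi^m$ if $(m,n)=1$, and $v_m\circ V_n=v_n\circ V_m$; (3) if $A$ is finite over $\mathbb Z$ (finitely generated as a $\mathbb Z$-module), then $A=0$. For a ring $B$ with $\lambda$-structure, let $\mathrm{max}_\lambda(B)$ be the set of kernels of surjective $\lambda$-morphisms $B\to A$ with $A$ étale over $\mathbb F_1$, i.e. a nonzero ring with $\lambda$-structure that is finite projective over $\mathbb Z$ and such that $A\otimes_{\mathbb Z}\mathbb Q$ is an étale $\mathbb Q$-algebra; and let $\mathrm{max}_{cycl}(B)$ be the set of kernels of surjective $\lambda$-morphisms $B\to\mathbb Z[\mu_n]$, $n\ge1$, where $\mathbb Z[\mu_n]$ is the integral group ring of the group $\mu_n$ of $n$-th roots of unity, with $\Psi^k(\zeta)=\zeta^k$ for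 $\zeta\in\mu_n$. Then (4) $\mathrm{max}_\lambda(w(R))=\emptyset=\mathrm{max}_{cycl}(w(R))$ for every ring $R$; in particular $\mathrm{max}_\lambda(w(\mathbb Z))=\mathrm{max}_{cycl}(w(\mathbb Z))=\emptyset$. -/

import Mathlib

open PowerSeries

universe u v

/-- The underlying set of the witty ring `w(R) = 1 + t R[[t]]`: the formal power series over `R`
with constant term `1`. -/
@[ext]
structure Witty (R : Type u) [CommRing R] where
  /-- the power series itself -/
  ser : R⟦X⟧
  const : constantCoeff ser = 1

namespace Witty

section Basic

variable {R : Type u} [CommRing R] {S : Type v} [CommRing S]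

/-- Addition `⊕` on `w(R)` is the multiplication of power series; the zero is the series `1`. -/
noncomputable instance : Add (Witty R) := ⟨fun u v => ⟨u.ser * v.ser, by simp [u.const, v.const]⟩⟩
noncomputable instance : Zero (Witty R) := ⟨⟨1, by simp⟩⟩
noncomputable instance : Neg (Witty R) := ⟨fun u => ⟨invOfUnit u.ser 1, by simp⟩⟩

theorem ser_add (u v : Witty R) : (u + v).ser = u.ser * v.ser := rfl
theorem ser_zero : (0 : Witty R).ser = 1 := rfl
theorem ser_neg (u : Witty R) : (-u).ser = invOfUnit u.ser 1 := rfl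
theorem ser_neg_mul (u : Witty R) : (-u).ser * u.ser = 1 :=
  invOfUnit_mul _ _ (by simpa using u.const)

noncomputable instance : AddCommGroup (Witty R) where
  add_assoc u v w := Witty.ext (mul_assoc _ _ _)
  zero_add u := Witty.ext (one_mul _)
  add_zero u := Witty.ext (mul_one _)
  neg_add_cancel u := Witty.ext (ser_neg_mul u)
  add_comm u v := Witty.ext (mul_comm _ _)
  nsmul := nsmulRec
  zsmul := zsmulRec

theorem coeff_zero (u : Witty R) : coeff 0 u.ser = 1 := by simpa using u.const

/-- The series `1 + t^(k+1) R[[t]]`. -/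
def Fil (k : ℕ) : AddSubgroup (Witty R) where
  carrier := {u | X ^ (k + 1) ∣ u.ser - 1}
  zero_mem' := by simp [ser_zero]
  add_mem' := by
    intro a b ha hb
    have h : (a + b).ser - 1 = (a.ser - 1) * b.ser + (b.ser - 1) := by rw [ser_add]; ring
    show X ^ (k + 1) ∣ (a + b).ser - 1
    rw [h]
    exact dvd_add (Dvd.dvd.mul_right ha _) hb
  neg_mem' := by
    intro a ha
    have h : (-a).ser - 1 = -((a.ser - 1) * (-a).ser) := by
      linear_combination (ser_neg_mul a)
    show X ^ (k + 1) ∣ (-a).ser - 1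
    rw [h]
    exact (Dvd.dvd.mul_right ha _).neg_right

theorem mem_fil {k : ℕ} {u : Witty R} : u ∈ Fil k ↔ X ^ (k + 1) ∣ u.ser - 1 := Iff.rfl

theorem sub_mem_fil {k : ℕ} {u v : Witty R} :
    u - v ∈ Fil k ↔ ∀ j ≤ k, coeff j u.ser = coeff j v.ser := by
  have h1 : (u - v).ser - 1 = (u.ser - v.ser) * (-v).ser := by
    rw [sub_eq_add_neg u v, ser_add]; linear_combination (ser_neg_mul v)
  have h2 : u.ser - v.ser = ((u - v).ser - 1) * v.ser := by
    rw [h1]; linear_combination (-(u.ser - v.ser)) * (ser_neg_mul v)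
  have h3 : u - v ∈ Fil k ↔ X ^ (k + 1) ∣ u.ser - v.ser := by
    rw [mem_fil]
    constructor
    · intro h; rw [h2]; exact h.mul_right _
    · intro h; rw [h1]; exact h.mul_right _
  rw [h3, X_pow_dvd_iff]
  simp only [map_sub, sub_eq_zero, Nat.lt_succ_iff]

theorem mem_fil_iff {k : ℕ} {u : Witty R} :
    u ∈ Fil k ↔ ∀ j ≤ k, j ≠ 0 → coeff j u.ser = 0 := by
  have := @sub_mem_fil R _ k u 0
  rw [sub_zero] at this
  rw [this]
  refine forall₂_congr fun j _ => ?_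
  rw [ser_zero, coeff_one]
  by_cases hj : j = 0
  · simp [hj, u.const]
  · simp [hj]

theorem fil_mono {j k : ℕ} (h : j ≤ k) {u : Witty R} (hu : u ∈ Fil k) : u ∈ Fil j :=
  mem_fil_iff.2 fun i hi h0 => mem_fil_iff.1 hu i (hi.trans h) h0

theorem eq_of_sub_mem_fil {u v : Witty R} (h : ∀ k, u - v ∈ Fil k) : u = v :=
  Witty.ext (PowerSeries.ext fun k => sub_mem_fil.1 (h k) k le_rfl)

/-- The map `w(R) → w(S)` obtained by applying a ring homomorphism to the coefficients, as a
homomorphism of additive groups. -/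
noncomputable def mapAdd (φ : R →+* S) : Witty R →+ Witty S where
  toFun u := ⟨PowerSeries.map φ u.ser, by
    rw [← coeff_zero_eq_constantCoeff_apply, coeff_map, coeff_zero, map_one]⟩
  map_zero' := Witty.ext (by simp [ser_zero])
  map_add' u v := Witty.ext (by simp [ser_add])

theorem coeff_mapAdd (φ : R →+* S) (u : Witty R) (k : ℕ) :
    coeff k (mapAdd φ u).ser = φ (coeff k u.ser) := coeff_map _ _ _

/-- `geom m a` is the geometric series `1 / (1 - a t^m)`, for `m ≥ 1`
(for `m = 0` it is the zero of `w(R)`). -/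
noncomputable def geom (m : ℕ) (a : R) : Witty R :=
  ⟨PowerSeries.mk fun k => if m ∣ k then a ^ (k / m) else 0, by
    rw [← coeff_zero_eq_constantCoeff_apply]; simp⟩

theorem coeff_geom (m : ℕ) (a : R) (k : ℕ) :
    coeff k (geom m a).ser = if m ∣ k then a ^ (k / m) else 0 := by
  rw [geom, coeff_mk]

theorem geom_zero (a : R) : geom 0 a = 0 := by
  refine Witty.ext (PowerSeries.ext fun k => ?_)
  rw [coeff_geom, ser_zero, coeff_one]
  by_cases hk : k = 0 <;> simp [hk]

theorem one_sub_mul_geom {m : ℕ} (hm : m ≠ 0) (a : R) :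
    (1 - C a * X ^ m) * (geom m a).ser = 1 := by
  refine PowerSeries.ext fun k => ?_
  rw [sub_mul, one_mul, map_sub, mul_assoc, coeff_C_mul, coeff_X_pow_mul', coeff_geom, coeff_geom,
    coeff_one]
  by_cases hk : k = 0
  · subst hk; simp [hm]
  · by_cases hd : m ∣ k
    · obtain ⟨q, rfl⟩ := hd
      obtain _ | q := q
      · simp at hk
      · have h1 : m * (q + 1) - m = m * q := by rw [mul_add, mul_one, Nat.add_sub_cancel]
        have h2 : m ≤ m * (q + 1) := Nat.le_mul_of_pos_right _ (by omega)
        simp [h1, h2, hm, Nat.mul_div_cancel_left _ (Nat.pos_of_ne_zero hm), pow_succ']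
    · have : m ≤ k → ¬ m ∣ k - m := fun h h' => hd ((Nat.dvd_sub_iff_left h dvd_rfl).1 h')
      by_cases hmk : m ≤ k
      · simp [hk, hd, this hmk]
      · simp [hk, hd, hmk]

theorem geom_mem_fil {m k : ℕ} (h : k < m) (a : R) : geom m a ∈ Fil k := by
  refine mem_fil_iff.2 fun j hj h0 => ?_
  rw [coeff_geom, if_neg]
  intro hd
  have := Nat.le_of_dvd (Nat.pos_of_ne_zero h0) hd
  omega

theorem mapAdd_geom (φ : R →+* S) (m : ℕ) (a : R) : mapAdd φ (geom m a) = geom m (φ a) := by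
  refine Witty.ext (PowerSeries.ext fun k => ?_)
  rw [coeff_mapAdd, coeff_geom, coeff_geom]
  split_ifs <;> simp

/-- The infinite sum `f 0 ⊕ f 1 ⊕ f 2 ⊕ ⋯` in `w(R)`, i.e. the `t`-adically convergent infinite
product of power series, for a sequence `f` such that `f i` is congruent to `1` modulo `t^(k+1)`
for all `i > c * k`. Its `k`-th coefficient is that of a sufficiently large finite sum. -/
noncomputable def infSum (c : ℕ) (f : ℕ → Witty R) : Witty R :=
  ⟨PowerSeries.mk fun k => coeff k (∑ i ∈ Finset.range (c * k + 1), f i).ser, by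
    rw [← coeff_zero_eq_constantCoeff_apply, coeff_mk, coeff_zero]⟩

theorem infSum_sub_sum_mem {c : ℕ} {f : ℕ → Witty R} (hf : ∀ k i, c * k < i → f i ∈ Fil k)
    {k N : ℕ} (hN : c * k < N) : infSum c f - ∑ i ∈ Finset.range N, f i ∈ Fil k := by
  refine sub_mem_fil.2 fun j hj => ?_
  have hle : c * j + 1 ≤ N := lt_of_le_of_lt (Nat.mul_le_mul_left c hj) hN
  have h : (∑ i ∈ Finset.range N, f i) - (∑ i ∈ Finset.range (c * j + 1), f i) ∈ Fil j := by
    rw [← Finset.sum_Ico_eq_sub _ hle]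
    refine AddSubgroup.sum_mem _ fun i hi => hf j i ?_
    have := (Finset.mem_Ico.1 hi).1
    omega
  rw [infSum, coeff_mk]
  exact (sub_mem_fil.1 h j le_rfl).symm

theorem infSum_mem_fil {c k : ℕ} {f : ℕ → Witty R} (hf : ∀ i, f i ∈ Fil k) :
    infSum c f ∈ Fil k := by
  refine mem_fil_iff.2 fun j hj h0 => ?_
  rw [infSum, coeff_mk]
  exact mem_fil_iff.1 (AddSubgroup.sum_mem _ fun i _ => hf i) j hj h0

theorem mapAdd_infSum (φ : R →+* S) (c : ℕ) (f : ℕ → Witty R) :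
    mapAdd φ (infSum c f) = infSum c fun i => mapAdd φ (f i) := by
  refine Witty.ext (PowerSeries.ext fun k => ?_)
  rw [coeff_mapAdd, infSum, infSum, coeff_mk, coeff_mk, ← map_sum, coeff_mapAdd]

/-- What remains of `u` after division by `1 / (1 - a_i t^i)` for all `i < k`. -/
noncomputable def rem (u : Witty R) : ℕ → Witty R
  | 0 => u
  | k + 1 => rem u k - geom k (coeff k (rem u k).ser)

/-- The elements `a_m` of `R`, for `m ≥ 1`, such that `u = ∏_{m ≥ 1} 1 / (1 - a_m t^m)`. -/
noncomputable def coord (u : Witty R) (m : ℕ) : R := coeff m (rem u m).ser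

theorem rem_succ (u : Witty R) (k : ℕ) : rem u (k + 1) = rem u k - geom k (coord u k) := rfl

theorem rem_mem_fil (u : Witty R) (k : ℕ) : rem u (k + 1) ∈ Fil k := by
  induction k with
  | zero => exact mem_fil_iff.2 fun j hj h0 => absurd (Nat.le_zero.1 hj) h0
  | succ k ih =>
    rw [rem_succ]
    refine sub_mem_fil.2 fun j hj => ?_
    rw [coeff_geom]
    by_cases h0 : j = 0
    · subst h0; simp [coeff_zero]
    rcases Nat.lt_or_ge j (k + 1) with h | h
    · rw [mem_fil_iff.1 ih j (by omega) h0, if_neg]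
      intro hd
      have := Nat.le_of_dvd (Nat.pos_of_ne_zero h0) hd
      omega
    · have : j = k + 1 := by omega
      subst this
      simp [coord]

theorem eq_rem_add (u : Witty R) (N : ℕ) :
    u = rem u N + ∑ i ∈ Finset.range N, geom i (coord u i) := by
  induction N with
  | zero => simp [rem]
  | succ N ih =>
    rw [Finset.sum_range_succ, rem_succ]
    conv_lhs => rw [ih]
    abel

/-- Every `u` in `w(R)` is the infinite product of the `1 / (1 - a_m t^m)`, with `a_m = coord u m`. -/
theorem eq_infSum_geom (u : Witty R) : u = infSum 1 fun i => geom i (coord u i) := by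
  refine eq_of_sub_mem_fil fun k => ?_
  have h := infSum_sub_sum_mem (R := R) (c := 1) (f := fun i => geom i (coord u i))
    (fun k i h => geom_mem_fil (by omega) _) (k := k) (N := k + 1) (by omega)
  have h2 := rem_mem_fil u k
  have h3 := sub_eq_iff_eq_add.2 (eq_rem_add u (k + 1))
  rw [← h3] at h2
  have := sub_mem h2 h
  rwa [sub_sub_sub_cancel_right] at this

theorem rem_mapAdd (φ : R →+* S) (u : Witty R) (k : ℕ) :
    rem (mapAdd φ u) k = mapAdd φ (rem u k) := by
  induction k with
  | zero => rfl
  | succ k ih => rw [rem_succ, rem_succ, coord, ih, coeff_mapAdd, ← mapAdd_geom, ← map_sub]; rfl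

theorem coord_mapAdd (φ : R →+* S) (u : Witty R) (k : ℕ) :
    coord (mapAdd φ u) k = φ (coord u k) := by
  rw [coord, rem_mapAdd, coeff_mapAdd]; rfl

/-- The multiplication `⊗` on `w(R)`: it is biadditive, compatible with infinite sums, and given by
`1/(1 - a t^i) ⊗ 1/(1 - b t^j) = (1/(1 - a^(j/g) b^(i/g) t^(lcm(i,j))))^g`, `g = gcd(i,j)`,
which for `i = j = 1` is the rule `1/(1 - a t) ⊗ 1/(1 - b t) = 1/(1 - a b t)`. -/
noncomputable instance : Mul (Witty R) :=
  ⟨fun u v => infSum 1 fun i => infSum 1 fun j =>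
    Nat.gcd i j • geom (Nat.lcm i j)
      (coord u i ^ (j / Nat.gcd i j) * coord v j ^ (i / Nat.gcd i j))⟩

/-- The unit of `w(R)` is `1/(1 - t) = 1 + t + t^2 + ⋯`. -/
noncomputable instance : One (Witty R) := ⟨geom 1 1⟩

/-- The underlying map of `Ψ^n` on `w(R)`, `n ≥ 1`: it is additive, compatible with infinite sums
and given by `Ψ^n (1/(1 - a t^i)) = (1/(1 - a^(n/g) t^(i/g)))^g`, `g = gcd(i,n)`, which for `i = 1`
is the rule `Ψ^n (1/(1 - a t)) = 1/(1 - a^n t)`. -/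
noncomputable def frob (n : ℕ) (u : Witty R) : Witty R :=
  infSum n fun i => Nat.gcd i n • geom (i / Nat.gcd i n) (coord u i ^ (n / Nat.gcd i n))

theorem mul_def (u v : Witty R) : u * v = infSum 1 fun i => infSum 1 fun j =>
    Nat.gcd i j • geom (Nat.lcm i j)
      (coord u i ^ (j / Nat.gcd i j) * coord v j ^ (i / Nat.gcd i j)) := rfl

theorem one_def : (1 : Witty R) = geom 1 1 := rfl

theorem mapAdd_mul (φ : R →+* S) (u v : Witty R) :
    mapAdd φ (u * v) = mapAdd φ u * mapAdd φ v := by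
  simp only [mul_def, mapAdd_infSum, map_nsmul, mapAdd_geom, coord_mapAdd, map_mul, map_pow]

theorem mapAdd_one (φ : R →+* S) : mapAdd φ 1 = 1 := by
  simp only [one_def, mapAdd_geom, map_one]

theorem mapAdd_frob (φ : R →+* S) (n : ℕ) (u : Witty R) :
    mapAdd φ (frob n u) = frob n (mapAdd φ u) := by
  simp only [frob, mapAdd_infSum, map_nsmul, mapAdd_geom, coord_mapAdd, map_pow]

/-- The logarithmic derivative `t u' / u`. -/
noncomputable def dlog : Witty R →+ R⟦X⟧ where
  toFun u := X * derivative R u.ser * (-u).ser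
  map_zero' := by
    have : derivative R (1 : R⟦X⟧) = 0 := derivative_one
    simp [ser_zero, this]
  map_add' u v := by
    have h1 := ser_neg_mul u
    have h2 := ser_neg_mul v
    rw [neg_add, ser_add, ser_add, Derivation.leibniz, smul_eq_mul, smul_eq_mul]
    linear_combination (X * derivative R v.ser * (-v).ser) * h1
      + (X * derivative R u.ser * (-u).ser) * h2

theorem ser_mul_dlog (u : Witty R) : u.ser * dlog u = X * derivative R u.ser := by
  have h1 := ser_neg_mul u
  show u.ser * (X * derivative R u.ser * (-u).ser) = _
  linear_combination (X * derivative R u.ser) * h1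

/-- The ghost maps `γ_n`, defined by `t u' / u = ∑ γ_n(u) t^n`. -/
noncomputable def ghost (n : ℕ) : Witty R →+ R :=
  (coeff n : R⟦X⟧ →ₗ[R] R).toAddMonoidHom.comp dlog

theorem ghost_def (n : ℕ) (u : Witty R) : ghost n u = coeff n (dlog u) := rfl

theorem ghost_zero (u : Witty R) : ghost 0 u = 0 := by
  rw [ghost_def]
  show coeff 0 (X * derivative R u.ser * (-u).ser) = 0
  simp [mul_assoc]

theorem ghost_of_mem_fil {k n : ℕ} (h : n ≤ k) {u : Witty R} (hu : u ∈ Fil k) : ghost n u = 0 := by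
  obtain ⟨w, hw⟩ := mem_fil.1 hu
  have hu' : u.ser = 1 + X ^ (k + 1) * w := by rw [← hw]; ring
  have hd : X ^ (k + 1) ∣ dlog u := by
    show _ ∣ X * derivative R u.ser * (-u).ser
    refine Dvd.dvd.mul_right ?_ _
    have h1 : derivative R (1 : R⟦X⟧) = 0 := derivative_one
    rw [hu', map_add, h1, Derivation.leibniz, Derivation.leibniz_pow, derivative_X]
    refine ⟨X * derivative R w + ((k : R⟦X⟧) + 1) * w, ?_⟩
    simp only [smul_eq_mul, nsmul_eq_mul, Nat.add_sub_cancel, Nat.cast_add, Nat.cast_one]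
    ring
  exact X_pow_dvd_iff.1 hd n (by omega)

theorem ghost_geom {m : ℕ} (hm : m ≠ 0) (a : R) {n : ℕ} (hn : n ≠ 0) :
    ghost n (geom m a) = if m ∣ n then (m : R) * a ^ (n / m) else 0 := by
  have h := one_sub_mul_geom hm a
  have h1 : derivative R (1 : R⟦X⟧) = 0 := derivative_one
  have hC : derivative R (C a : R⟦X⟧) = 0 := derivative_C
  have hd := congrArg (derivative R) h
  rw [Derivation.leibniz, map_sub, h1, Derivation.leibniz, hC, Derivation.leibniz_pow,
    derivative_X] at hd
  simp only [smul_eq_mul, nsmul_eq_mul, mul_one, mul_zero, add_zero, zero_sub] at hd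
  have hX : X * (X : R⟦X⟧) ^ (m - 1) = X ^ m := by
    rw [← pow_succ']; congr 1; omega
  have hn' := ser_neg_mul (geom m a)
  have key : dlog (geom m a) = C ((m : R) * a) * (X ^ m * (geom m a).ser) := by
    show X * derivative R (geom m a).ser * (-(geom m a)).ser = _
    have e1 : (-(geom m a)).ser = 1 - C a * X ^ m := by
      linear_combination (1 - C a * X ^ m) * hn' - (-(geom m a)).ser * h
    rw [e1, map_mul, map_natCast]
    linear_combination X * hd + (m : R⟦X⟧) * C a * (geom m a).ser * hX
  rw [ghost_def, key, coeff_C_mul, coeff_X_pow_mul', coeff_geom]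
  by_cases hd : m ∣ n
  · obtain ⟨q, rfl⟩ := hd
    obtain _ | q := q
    · simp at hn
    · have h1 : m * (q + 1) - m = m * q := by rw [mul_add, mul_one, Nat.add_sub_cancel]
      have h2 : m ≤ m * (q + 1) := Nat.le_mul_of_pos_right _ (by omega)
      simp [h1, h2, Nat.mul_div_cancel_left _ (Nat.pos_of_ne_zero hm), pow_succ', mul_assoc]
  · have : m ≤ n → ¬ m ∣ n - m := fun h h' => hd ((Nat.dvd_sub_iff_left h dvd_rfl).1 h')
    by_cases hmk : m ≤ n
    · simp [hd, this hmk]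
    · simp [hd, hmk]

theorem ghost_infSum {c : ℕ} {f : ℕ → Witty R} (hf : ∀ k i, c * k < i → f i ∈ Fil k)
    {n N : ℕ} (hN : c * n < N) : ghost n (infSum c f) = ∑ i ∈ Finset.range N, ghost n (f i) := by
  have h := ghost_of_mem_fil le_rfl (infSum_sub_sum_mem hf hN)
  rw [map_sub, map_sum, sub_eq_zero] at h
  exact h

/-- The contribution of `1/(1 - a t^i)` to the `n`-th ghost component. -/
theorem ghost_geom' (i : ℕ) (a : R) {n : ℕ} (hn : n ≠ 0) :
    ghost n (geom i a) = if i ∣ n then (i : R) * a ^ (n / i) else 0 := by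
  by_cases hi : i = 0
  · subst hi
    rw [geom_zero, map_zero]; simp
  · exact ghost_geom hi a hn

theorem ghost_eq_sum (u : Witty R) {n N : ℕ} (hn : n ≠ 0) (hN : n < N) :
    ghost n u = ∑ i ∈ Finset.range N, if i ∣ n then (i : R) * coord u i ^ (n / i) else 0 := by
  conv_lhs => rw [eq_infSum_geom u]
  rw [ghost_infSum (fun k i h => geom_mem_fil (by omega) _) (N := N) (by omega)]
  exact Finset.sum_congr rfl fun i _ => ghost_geom' i _ hn

theorem ghost_mul (n : ℕ) (u v : Witty R) : ghost n (u * v) = ghost n u * ghost n v := by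
  by_cases hn : n = 0
  · subst hn; simp [ghost_zero]
  have hfil : ∀ k i j : ℕ, k < i ∨ k < j → Nat.gcd i j • geom (Nat.lcm i j)
      (coord u i ^ (j / Nat.gcd i j) * coord v j ^ (i / Nat.gcd i j)) ∈ Fil k := by
    intro k i j h
    refine AddSubgroup.nsmul_mem _ ?_ _
    by_cases h0 : Nat.lcm i j = 0
    · rw [h0, geom_zero]; exact zero_mem _
    · refine geom_mem_fil ?_ _
      have h1 := Nat.le_of_dvd (Nat.pos_of_ne_zero h0) (Nat.dvd_lcm_left i j)
      have h2 := Nat.le_of_dvd (Nat.pos_of_ne_zero h0) (Nat.dvd_lcm_right i j)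
      omega
  rw [mul_def, ghost_infSum (N := n + 1) (fun k i h => infSum_mem_fil fun j =>
    hfil k i j (Or.inl (by omega))) (by omega), ghost_eq_sum u hn (Nat.lt_succ_self n),
    ghost_eq_sum v hn (Nat.lt_succ_self n), Finset.sum_mul_sum]
  refine Finset.sum_congr rfl fun i _ => ?_
  rw [ghost_infSum (N := n + 1) (fun k j h => hfil k i j (Or.inr (by omega))) (by omega)]
  refine Finset.sum_congr rfl fun j _ => ?_
  rw [map_nsmul, ghost_geom' _ _ hn, nsmul_eq_mul]
  by_cases hi : i ∣ n
  · by_cases hj : j ∣ n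
    · rw [if_pos (Nat.lcm_dvd hi hj), if_pos hi, if_pos hj, mul_pow, ← pow_mul, ← pow_mul,
        ← mul_assoc, ← Nat.cast_mul, Nat.gcd_mul_lcm]
      have hi0 : 0 < i := Nat.pos_of_dvd_of_pos hi (Nat.pos_of_ne_zero hn)
      have hj0 : 0 < j := Nat.pos_of_dvd_of_pos hj (Nat.pos_of_ne_zero hn)
      have e : ∀ x y : ℕ, 0 < x → 0 < y → Nat.lcm x y ∣ n →
          y / Nat.gcd x y * (n / Nat.lcm x y) = n / x := by
        intro x y hx hy ⟨q, hq⟩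
        have hl : 0 < Nat.lcm x y := Nat.lcm_pos hx hy
        have hxl : Nat.lcm x y = x * (y / Nat.gcd x y) := by
          rw [Nat.lcm, Nat.mul_div_assoc _ (Nat.gcd_dvd_right x y)]
        rw [hq, Nat.mul_div_cancel_left _ hl, hxl, mul_assoc, Nat.mul_div_cancel_left _ hx]
      have e1 := e i j hi0 hj0 (Nat.lcm_dvd hi hj)
      have e2 := e j i hj0 hi0 (Nat.lcm_dvd hj hi)
      rw [Nat.gcd_comm, Nat.lcm_comm] at e2
      rw [e1, e2, Nat.cast_mul]
      ring
    · rw [if_neg hj, mul_zero, if_neg fun h => hj ((Nat.dvd_lcm_right i j).trans h), mul_zero]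
  · rw [if_neg hi, zero_mul, if_neg fun h => hi ((Nat.dvd_lcm_left i j).trans h), mul_zero]

theorem ghost_one {n : ℕ} (hn : n ≠ 0) : ghost n (1 : Witty R) = 1 := by
  rw [one_def, ghost_geom' _ _ hn]; simp

theorem ghost_frob {m : ℕ} (hm : m ≠ 0) (n : ℕ) (u : Witty R) :
    ghost n (frob m u) = ghost (m * n) u := by
  by_cases hn : n = 0
  · subst hn; simp [ghost_zero]
  rw [frob, ghost_infSum (N := m * n + 1) _ (by omega), ghost_eq_sum u
    (Nat.mul_ne_zero hm hn) (Nat.lt_succ_self _)]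
  · refine Finset.sum_congr rfl fun i _ => ?_
    rw [map_nsmul, ghost_geom' _ _ hn, nsmul_eq_mul]
    have hg : 0 < Nat.gcd i m := Nat.gcd_pos_of_pos_right _ (Nat.pos_of_ne_zero hm)
    obtain ⟨i', hi'⟩ := Nat.gcd_dvd_left i m
    obtain ⟨m', hm'⟩ := Nat.gcd_dvd_right i m
    have hdi : i / Nat.gcd i m = i' := Nat.div_eq_of_eq_mul_right hg hi'
    have hdm : m / Nat.gcd i m = m' := Nat.div_eq_of_eq_mul_right hg hm'
    have hcop : Nat.Coprime i' m' := by
      have := Nat.coprime_div_gcd_div_gcd hg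
      rwa [hdi, hdm] at this
    have hiff : i' ∣ n ↔ i ∣ m * n := by
      have e : i ∣ m * n ↔ Nat.gcd i m * i' ∣ Nat.gcd i m * (m' * n) := by
        rw [← mul_assoc, ← hi', ← hm']
      rw [e, Nat.mul_dvd_mul_iff_left hg]
      exact (hcop.dvd_mul_left).symm
    rw [hdi, hdm]
    by_cases h : i' ∣ n
    · rw [if_pos h, if_pos (hiff.1 h), ← pow_mul, ← mul_assoc, ← Nat.cast_mul, ← hi']
      obtain ⟨q, rfl⟩ := h
      have hi0 : 0 < i' := by
        rcases Nat.eq_zero_or_pos i' with h0 | h0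
        · subst h0; simp at hn
        · exact h0
      have hi00 : 0 < i := by rw [hi']; exact Nat.mul_pos hg hi0
      have e : m * (i' * q) / i = m' * q := by
        refine Nat.div_eq_of_eq_mul_right hi00 ?_
        conv_lhs => rw [hm']
        conv_rhs => rw [hi']
        ring
      rw [e, Nat.mul_div_cancel_left _ hi0]
    · rw [if_neg h, if_neg (fun h' => h (hiff.2 h')), mul_zero]
  · intro k i h
    refine AddSubgroup.nsmul_mem _ (geom_mem_fil ?_ _) _
    have hg : 0 < Nat.gcd i m := Nat.gcd_pos_of_pos_right _ (Nat.pos_of_ne_zero hm)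
    rw [Nat.lt_div_iff_mul_lt' (Nat.gcd_dvd_left i m)]
    refine lt_of_le_of_lt ?_ h
    exact Nat.mul_le_mul_right _ (Nat.le_of_dvd (Nat.pos_of_ne_zero hm) (Nat.gcd_dvd_right i m))

/-- Over a torsion-free ring the ghost components determine the series. -/
theorem mem_fil_of_ghost [IsAddTorsionFree R] {k : ℕ} {u : Witty R}
    (h : ∀ n ≤ k, ghost n u = 0) : u ∈ Fil k := by
  refine mem_fil_iff.2 fun j hj h0 => ?_
  have hd : X ^ (k + 1) ∣ X * derivative R u.ser := by
    rw [← ser_mul_dlog]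
    exact Dvd.dvd.mul_left (X_pow_dvd_iff.2 fun n hn => h n (by omega)) _
  have h1 := X_pow_dvd_iff.1 hd j (by omega)
  obtain _ | j := j
  · exact absurd rfl h0
  rw [coeff_succ_X_mul, coeff_derivative] at h1
  have h2 : (j + 1) • coeff (j + 1) u.ser = 0 := by
    rw [nsmul_eq_mul, mul_comm]; exact_mod_cast h1
  exact (smul_eq_zero_iff_right (Nat.succ_ne_zero j)).1 h2

theorem ghost_injective [IsAddTorsionFree R] {u v : Witty R} (h : ∀ n, ghost n u = ghost n v) :
    u = v :=
  eq_of_sub_mem_fil fun _ => mem_fil_of_ghost fun n _ => by rw [map_sub, h, sub_self]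

end Basic

/-- Reduction to the torsion-free case. -/
theorem exists_lift (R : Type u) [CommRing R] : ∃ (B : Type u) (_ : CommRing B)
    (_ : IsAddTorsionFree B) (φ : B →+* R), ∀ u : Witty R, ∃ u' : Witty B, mapAdd φ u' = u := by
  refine ⟨MvPolynomial R ℤ, inferInstance, inferInstance,
    MvPolynomial.eval₂Hom (Int.castRingHom R) id, fun u => ?_⟩
  refine ⟨⟨PowerSeries.mk fun k => if k = 0 then 1 else MvPolynomial.X (coeff k u.ser), ?_⟩, ?_⟩
  · rw [← coeff_zero_eq_constantCoeff_apply]; simp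
  · refine Witty.ext (PowerSeries.ext fun k => ?_)
    rw [coeff_mapAdd, coeff_mk]
    by_cases hk : k = 0
    · subst hk; simp [u.const]
    · simp [hk]

section Ring

variable {R : Type u} [CommRing R] {S : Type v} [CommRing S]

noncomputable instance : CommRing (Witty R) :=
  { (inferInstance : AddCommGroup (Witty R)), (inferInstance : Mul (Witty R)),
    (inferInstance : One (Witty R)) with
    mul_comm := by
      obtain ⟨B, _, _, φ, h⟩ := exists_lift R
      intro u v
      obtain ⟨u, rfl⟩ := h u
      obtain ⟨v, rfl⟩ := h v
      rw [← mapAdd_mul, ← mapAdd_mul]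
      exact congrArg _ (ghost_injective fun n => by rw [ghost_mul, ghost_mul, mul_comm])
    mul_assoc := by
      obtain ⟨B, _, _, φ, h⟩ := exists_lift R
      intro u v w
      obtain ⟨u, rfl⟩ := h u
      obtain ⟨v, rfl⟩ := h v
      obtain ⟨w, rfl⟩ := h w
      simp only [← mapAdd_mul]
      exact congrArg _ (ghost_injective fun n => by simp only [ghost_mul, mul_assoc])
    one_mul := by
      obtain ⟨B, _, _, φ, h⟩ := exists_lift R
      intro u
      obtain ⟨u, rfl⟩ := h u
      rw [← mapAdd_one φ, ← mapAdd_mul]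
      refine congrArg _ (ghost_injective fun n => ?_)
      by_cases hn : n = 0
      · subst hn; simp only [ghost_zero]
      · rw [ghost_mul, ghost_one hn, one_mul]
    mul_one := by
      obtain ⟨B, _, _, φ, h⟩ := exists_lift R
      intro u
      obtain ⟨u, rfl⟩ := h u
      rw [← mapAdd_one φ, ← mapAdd_mul]
      refine congrArg _ (ghost_injective fun n => ?_)
      by_cases hn : n = 0
      · subst hn; simp only [ghost_zero]
      · rw [ghost_mul, ghost_one hn, mul_one]
    left_distrib := by
      obtain ⟨B, _, _, φ, h⟩ := exists_lift R
      intro u v w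
      obtain ⟨u, rfl⟩ := h u
      obtain ⟨v, rfl⟩ := h v
      obtain ⟨w, rfl⟩ := h w
      simp only [← mapAdd_mul, ← map_add]
      exact congrArg _ (ghost_injective fun n => by simp only [ghost_mul, map_add, mul_add])
    right_distrib := by
      obtain ⟨B, _, _, φ, h⟩ := exists_lift R
      intro u v w
      obtain ⟨u, rfl⟩ := h u
      obtain ⟨v, rfl⟩ := h v
      obtain ⟨w, rfl⟩ := h w
      simp only [← mapAdd_mul, ← map_add]
      exact congrArg _ (ghost_injective fun n => by simp only [ghost_mul, map_add, add_mul])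
    zero_mul := by
      obtain ⟨B, _, _, φ, h⟩ := exists_lift R
      intro u
      obtain ⟨u, rfl⟩ := h u
      rw [← (mapAdd φ).map_zero, ← mapAdd_mul]
      exact congrArg _ (ghost_injective fun n => by rw [ghost_mul, map_zero, zero_mul])
    mul_zero := by
      obtain ⟨B, _, _, φ, h⟩ := exists_lift R
      intro u
      obtain ⟨u, rfl⟩ := h u
      rw [← (mapAdd φ).map_zero, ← mapAdd_mul]
      exact congrArg _ (ghost_injective fun n => by rw [ghost_mul, map_zero, mul_zero]) }

/-- The defining rule of the multiplication. -/
theorem geom_one_mul_geom_one (a b : R) : geom 1 a * geom 1 b = geom 1 (a * b) := by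
  let φ : MvPolynomial (Fin 2) ℤ →+* R := MvPolynomial.eval₂Hom (Int.castRingHom R) ![a, b]
  have ha : a = φ (MvPolynomial.X 0) := by simp [φ]
  have hb : b = φ (MvPolynomial.X 1) := by simp [φ]
  rw [ha, hb, ← map_mul, ← mapAdd_geom, ← mapAdd_geom, ← mapAdd_geom, ← mapAdd_mul]
  refine congrArg _ (ghost_injective fun n => ?_)
  by_cases hn : n = 0
  · subst hn; simp only [ghost_zero]
  · rw [ghost_mul, ghost_geom' _ _ hn, ghost_geom' _ _ hn, ghost_geom' _ _ hn]
    simp [mul_pow]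

/-- The ring endomorphism `Ψ^n` of `w(R)`, for `n ≥ 1`. -/
noncomputable def psiHom (n : ℕ+) : Witty R →+* Witty R where
  toFun := frob n
  map_one' := by
    obtain ⟨B, _, _, φ, h⟩ := exists_lift R
    rw [← mapAdd_one φ, ← mapAdd_frob]
    refine congrArg _ (ghost_injective fun k => ?_)
    by_cases hk : k = 0
    · subst hk; simp only [ghost_zero]
    · rw [ghost_frob n.ne_zero, ghost_one hk, ghost_one (Nat.mul_ne_zero n.ne_zero hk)]
  map_mul' := by
    obtain ⟨B, _, _, φ, h⟩ := exists_lift R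
    intro u v
    obtain ⟨u, rfl⟩ := h u
    obtain ⟨v, rfl⟩ := h v
    simp only [← mapAdd_mul, ← mapAdd_frob]
    exact congrArg _ (ghost_injective fun k => by simp only [ghost_frob n.ne_zero, ghost_mul])
  map_zero' := by
    obtain ⟨B, _, _, φ, h⟩ := exists_lift R
    rw [← (mapAdd φ).map_zero, ← mapAdd_frob]
    exact congrArg _ (ghost_injective fun k => by simp only [ghost_frob n.ne_zero, map_zero])
  map_add' := by
    obtain ⟨B, _, _, φ, h⟩ := exists_lift R
    intro u v
    obtain ⟨u, rfl⟩ := h u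
    obtain ⟨v, rfl⟩ := h v
    simp only [← map_add, ← mapAdd_frob]
    exact congrArg _ (ghost_injective fun k => by simp only [ghost_frob n.ne_zero, map_add])

theorem psiHom_apply (n : ℕ+) (u : Witty R) : psiHom n u = frob n u := rfl

/-- The defining rule of `Ψ^n`. -/
theorem psiHom_geom_one (n : ℕ+) (a : R) : psiHom n (geom 1 a) = geom 1 (a ^ (n : ℕ)) := by
  let φ : MvPolynomial (Fin 1) ℤ →+* R := MvPolynomial.eval₂Hom (Int.castRingHom R) ![a]
  have ha : a = φ (MvPolynomial.X 0) := by simp [φ]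
  rw [ha, ← map_pow, psiHom_apply, ← mapAdd_geom, ← mapAdd_geom, ← mapAdd_frob]
  refine congrArg _ (ghost_injective fun k => ?_)
  by_cases hk : k = 0
  · subst hk; simp only [ghost_zero]
  · rw [ghost_frob n.ne_zero, ghost_geom' _ _ hk, ghost_geom' _ _ (Nat.mul_ne_zero n.ne_zero hk)]
    simp [pow_mul]

/-- The Verschiebung operator `V_n`, for `n ≥ 1`: the additive map `s(t) ↦ s(t^n)`. -/
noncomputable def verschiebung (n : ℕ+) : Witty R →+ Witty R where
  toFun u := ⟨expand n n.ne_zero u.ser, by rw [constantCoeff_expand, u.const]⟩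
  map_zero' := Witty.ext (by simp [ser_zero])
  map_add' u v := Witty.ext (by simp [ser_add])

/-- The additive map `v_n`, the composition of `V_n` with the projection `w(R) → w(R)/I`. -/
noncomputable def verschiebungQuot (I : Ideal (Witty R)) (n : ℕ+) : Witty R →+ Witty R ⧸ I :=
  (Ideal.Quotient.mk I).toAddMonoidHom.comp (verschiebung n)

theorem psi_geom_aux [IsAddTorsionFree R] {p : ℕ} (hp : p.Prime) (i : ℕ) (a : R) :
    ∃ y : Witty R, frob p (geom i a) - geom i a ^ p = p • y := by
  by_cases hi : i = 0
  · subst hi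
    refine ⟨0, ?_⟩
    have : frob p (0 : Witty R) = 0 := (psiHom (Nat.toPNat p hp.pos)).map_zero
    rw [geom_zero, this, zero_pow hp.ne_zero, sub_zero, smul_zero]
  have ghost_pow : ∀ (n : ℕ), n ≠ 0 → ∀ (u : Witty R) (k : ℕ),
      ghost n (u ^ k) = ghost n u ^ k := by
    intro n hn u k
    induction k with
    | zero => rw [pow_zero, pow_zero, ghost_one hn]
    | succ k ih => rw [pow_succ, pow_succ, ghost_mul, ih]
  have h1 : geom i a ^ p = i ^ (p - 1) • geom i (a ^ p) := by
    refine ghost_injective fun n => ?_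
    by_cases hn : n = 0
    · subst hn; simp only [ghost_zero]
    rw [ghost_pow n hn, map_nsmul, ghost_geom' _ _ hn, ghost_geom' _ _ hn]
    split_ifs with h
    · rw [mul_pow, nsmul_eq_mul, Nat.cast_pow, ← mul_assoc, ← pow_succ, Nat.sub_add_cancel hp.pos,
        ← pow_mul, ← pow_mul, mul_comm p]
    · rw [zero_pow hp.ne_zero, smul_zero]
  rw [h1]
  by_cases hd : p ∣ i
  · obtain ⟨j, rfl⟩ := hd
    have hj : j ≠ 0 := by rintro rfl; simp at hi
    have h2 : frob p (geom (p * j) a) = p • geom j a := by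
      refine ghost_injective fun n => ?_
      by_cases hn : n = 0
      · subst hn; simp only [ghost_zero]
      rw [ghost_frob hp.ne_zero, map_nsmul, ghost_geom' _ _ hn,
        ghost_geom' _ _ (Nat.mul_ne_zero hp.ne_zero hn), Nat.mul_div_mul_left _ _ hp.pos]
      simp only [Nat.mul_dvd_mul_iff_left hp.pos]
      split_ifs
      · rw [nsmul_eq_mul, Nat.cast_mul, mul_assoc]
      · rw [smul_zero]
    obtain ⟨q, hq⟩ : p ∣ (p * j) ^ (p - 1) :=
      dvd_pow (dvd_mul_right p j) (by have := hp.two_le; omega)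
    refine ⟨geom j a - q • geom (p * j) (a ^ p), ?_⟩
    rw [h2, hq, mul_nsmul', smul_sub]
  · have h2 : frob p (geom i a) = geom i (a ^ p) := by
      refine ghost_injective fun n => ?_
      by_cases hn : n = 0
      · subst hn; simp only [ghost_zero]
      have hc : Nat.Coprime i p := ((Nat.Prime.coprime_iff_not_dvd hp).2 hd).symm
      rw [ghost_frob hp.ne_zero, ghost_geom' _ _ hn,
        ghost_geom' _ _ (Nat.mul_ne_zero hp.ne_zero hn)]
      simp only [hc.dvd_mul_left]
      split_ifs with h
      · rw [Nat.mul_div_assoc _ h, pow_mul]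
      · rfl
    obtain ⟨q, hq⟩ : p ∣ i ^ (p - 1) - 1 := by
      have := Fact.mk hp
      have h3 : (i : ZMod p) ≠ 0 := by rwa [Ne, ZMod.natCast_eq_zero_iff]
      have h4 := ZMod.pow_card_sub_one_eq_one h3
      rw [← ZMod.natCast_eq_zero_iff, Nat.cast_sub (Nat.one_le_pow _ _ (Nat.pos_of_ne_zero hi))]
      simp [h4]
    refine ⟨-(q • geom i (a ^ p)), ?_⟩
    have h5 : i ^ (p - 1) = p * q + 1 := by
      have := Nat.one_le_pow (p - 1) i (Nat.pos_of_ne_zero hi)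
      omega
    rw [h2, h5, add_smul, one_smul, mul_nsmul', smul_neg]
    abel

/-- `Ψ^p` lifts the Frobenius, torsion-free case, modulo `t^(N+1)`. -/
theorem psi_approx [IsAddTorsionFree R] {p : ℕ} (hp : p.Prime) (u : Witty R) (N : ℕ) :
    ∃ y : Witty R, frob p u - u ^ p - p • y ∈ Fil N := by
  let J : Ideal (Witty R) :=
    { Fil N with
      smul_mem' := fun c x hx => mem_fil_of_ghost fun n hn => by
        show ghost n (c * x) = 0
        rw [ghost_mul, ghost_of_mem_fil hn hx, mul_zero] }
  have hJ : ∀ x, x ∈ J ↔ x ∈ Fil N := fun _ => Iff.rfl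
  let ψ : Witty R →+* Witty R := psiHom (Nat.toPNat p hp.pos)
  have hψ : ∀ x, ψ x = frob p x := fun _ => rfl
  -- the set of elements for which the congruence holds is an additive subgroup
  let P : Ideal (Witty R) := J ⊔ Ideal.span {(p : Witty R)}
  have hP : ∀ x, x ∈ P → ∃ y : Witty R, x - p • y ∈ Fil N := by
    intro x hx
    obtain ⟨a, ha, b, hb, rfl⟩ := Submodule.mem_sup.1 hx
    obtain ⟨c, rfl⟩ := Ideal.mem_span_singleton.1 hb
    refine ⟨c, ?_⟩
    rw [nsmul_eq_mul, add_sub_cancel_right]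
    exact ha
  have hp' : (p : Witty R) ∈ P := Ideal.mem_sup_right (Ideal.mem_span_singleton_self _)
  have hadd : ∀ x y, ψ x - x ^ p ∈ P → ψ y - y ^ p ∈ P → ψ (x + y) - (x + y) ^ p ∈ P := by
    intro x y hx hy
    obtain ⟨r, hr⟩ := exists_add_pow_prime_eq hp x y
    have : ψ (x + y) - (x + y) ^ p = (ψ x - x ^ p) + (ψ y - y ^ p) - p * (x * y * r) := by
      rw [hr, map_add]; ring
    rw [this]
    exact P.sub_mem (P.add_mem hx hy) (P.mul_mem_right _ hp')
  refine hP _ ?_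
  have hsum : ∀ M, ψ (∑ i ∈ Finset.range M, geom i (coord u i))
      - (∑ i ∈ Finset.range M, geom i (coord u i)) ^ p ∈ P := by
    intro M
    induction M with
    | zero => simp [zero_pow hp.ne_zero]
    | succ M ih =>
      rw [Finset.sum_range_succ]
      refine hadd _ _ ih ?_
      obtain ⟨y, hy⟩ := psi_geom_aux hp M (coord u M)
      rw [hψ, hy, nsmul_eq_mul]
      exact P.mul_mem_right _ hp'
  have hrem : ψ (rem u (p * N + 1)) - rem u (p * N + 1) ^ p ∈ P := by
    have hr := rem_mem_fil u (p * N)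
    refine Ideal.mem_sup_left (J.sub_mem ?_ ?_)
    · refine (hJ _).2 (mem_fil_of_ghost fun n hn => ?_)
      rw [hψ, ghost_frob hp.ne_zero]
      exact ghost_of_mem_fil (Nat.mul_le_mul_left p hn) hr
    · exact J.pow_mem_of_mem ((hJ _).2 (fil_mono (Nat.le_mul_of_pos_left N hp.pos) hr)) p hp.pos
  have := hadd _ _ hrem (hsum (p * N + 1))
  rwa [← eq_rem_add] at this

/-- `Ψ^p` is a lift of the Frobenius of `w(R)/p`, for every prime number `p`. -/
theorem dvd_psiHom_sub_pow (p : ℕ+) (hp : (p : ℕ).Prime) (u : Witty R) :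
    ((p : ℕ) : Witty R) ∣ psiHom p u - u ^ (p : ℕ) := by
  obtain ⟨B, _, _, φ, h⟩ := exists_lift R
  obtain ⟨u, rfl⟩ := h u
  choose y hy using psi_approx hp u
  have hstep : ∀ M N, N ≤ M → y M - y N ∈ Fil N := by
    intro M N hNM
    have h1 := sub_mem (hy N) (fil_mono hNM (hy M))
    rw [sub_sub_sub_cancel_left, ← smul_sub] at h1
    refine mem_fil_of_ghost fun n hn => ?_
    have h2 := ghost_of_mem_fil hn h1
    rw [map_nsmul] at h2
    exact (smul_eq_zero_iff_right hp.ne_zero).1 h2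
  let z : Witty B := ⟨PowerSeries.mk fun k => coeff k (y k).ser, by
    rw [← coeff_zero_eq_constantCoeff_apply, coeff_mk, coeff_zero]⟩
  have hz : ∀ N, z - y N ∈ Fil N := fun N => sub_mem_fil.2 fun j hj => by
    show coeff j (PowerSeries.mk fun k => coeff k (y k).ser) = _
    rw [coeff_mk]
    exact (sub_mem_fil.1 (hstep N j hj) j le_rfl).symm
  have hfin : frob p u - u ^ (p : ℕ) = (p : ℕ) • z := eq_of_sub_mem_fil fun N => by
    have h1 := sub_mem (hy N) (AddSubgroup.nsmul_mem _ (hz N) (p : ℕ))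
    rw [smul_sub, sub_sub, add_sub_cancel] at h1
    exact h1
  have hpow : ∀ k : ℕ, mapAdd φ (u ^ k) = mapAdd φ u ^ k := by
    intro k
    induction k with
    | zero => rw [pow_zero, pow_zero, mapAdd_one]
    | succ k ih => rw [pow_succ, pow_succ, mapAdd_mul, ih]
  refine ⟨mapAdd φ z, ?_⟩
  rw [psiHom_apply, ← nsmul_eq_mul, ← map_nsmul, ← hfin, map_sub, hpow, mapAdd_frob]

end Ring

end Witty

/-- A `λ`-structure on a commutative ring `A`, given by its Adams operations: ring endomorphisms
`Ψ^n`, `n ≥ 1`, with `Ψ^1 = id` and `Ψ^(mn) = Ψ^m ∘ Ψ^n` (so that they commute), such that `Ψ^p`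
lifts the Frobenius of `A/pA` for every prime number `p`. A `λ`-ring is a commutative ring without
additive torsion (`IsAddTorsionFree A`) together with such a structure. -/
class LambdaStructure (A : Type u) [CommRing A] where
  /-- the operations `Ψ^n` -/
  psi : ℕ+ →* (A →+* A)
  frobenius_lift : ∀ p : ℕ+, (p : ℕ).Prime → ∀ a : A,
    ((p : ℕ) : A) ∣ psi p a - a ^ (p : ℕ)

open LambdaStructure

/-- The `λ`-structure on the witty ring `w(R)`. -/
noncomputable instance Witty.instLambdaStructure (R : Type u) [CommRing R] :
    LambdaStructure (Witty R) where
  psi :=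
    { toFun := Witty.psiHom
      map_one' := by
        obtain ⟨B, _, _, φ, h⟩ := Witty.exists_lift R
        refine RingHom.ext fun u => ?_
        obtain ⟨u, rfl⟩ := h u
        rw [RingHom.one_def, RingHom.id_apply, Witty.psiHom_apply, ← Witty.mapAdd_frob]
        refine congrArg _ (Witty.ghost_injective fun k => ?_)
        rw [Witty.ghost_frob (PNat.ne_zero 1), PNat.one_coe, one_mul]
      map_mul' := fun m n => by
        obtain ⟨B, _, _, φ, h⟩ := Witty.exists_lift R
        refine RingHom.ext fun u => ?_
        obtain ⟨u, rfl⟩ := h u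
        rw [RingHom.mul_def, RingHom.comp_apply, Witty.psiHom_apply, Witty.psiHom_apply,
          Witty.psiHom_apply, ← Witty.mapAdd_frob, ← Witty.mapAdd_frob, ← Witty.mapAdd_frob]
        refine congrArg _ (Witty.ghost_injective fun k => ?_)
        rw [Witty.ghost_frob (PNat.ne_zero _), Witty.ghost_frob (PNat.ne_zero _),
          Witty.ghost_frob (PNat.ne_zero _), PNat.mul_coe, mul_comm (m : ℕ) (n : ℕ), mul_assoc] }
  frobenius_lift := Witty.dvd_psiHom_sub_pow

/-- If `R` has no additive torsion then neither has `w(R)`, so that `w(R)` is a `λ`-ring. -/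
instance Witty.instIsAddTorsionFree (R : Type u) [CommRing R] [IsAddTorsionFree R] :
    IsAddTorsionFree (Witty R) where
  nsmul_right_injective n hn u v h := Witty.ghost_injective fun k => by
    have h1 := congrArg (Witty.ghost k) h
    simp only [map_nsmul] at h1
    exact nsmul_right_injective hn h1

/-- The `λ`-structure on the integral group ring `ℤ[G]` of a commutative group `G`, with
`Ψ^n(g) = g^n` for `g` in `G`. -/
noncomputable instance MonoidAlgebra.instLambdaStructure (G : Type u) [CommGroup G] :
    LambdaStructure (MonoidAlgebra ℤ G) where
  psi :=
    { toFun := fun n => MonoidAlgebra.mapDomainRingHom ℤ (powMonoidHom (n : ℕ) : G →* G)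
      map_one' := by
        refine MonoidAlgebra.ringHom_ext' (RingHom.ext_int _ _) (MonoidHom.ext fun g => ?_)
        simp [RingHom.one_def]
      map_mul' := fun m n => by
        refine MonoidAlgebra.ringHom_ext' (RingHom.ext_int _ _) (MonoidHom.ext fun g => ?_)
        simp [RingHom.mul_def, ← pow_mul, mul_comm] }
  frobenius_lift := fun p hp a => by
    let ψ := MonoidAlgebra.mapDomainRingHom ℤ (powMonoidHom (p : ℕ) : G →* G)
    show _ ∣ ψ a - a ^ (p : ℕ)
    have hadd : ∀ x y : MonoidAlgebra ℤ G, ((p : ℕ) : MonoidAlgebra ℤ G) ∣ ψ x - x ^ (p : ℕ) →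
        ((p : ℕ) : MonoidAlgebra ℤ G) ∣ ψ y - y ^ (p : ℕ) →
        ((p : ℕ) : MonoidAlgebra ℤ G) ∣ ψ (x + y) - (x + y) ^ (p : ℕ) := by
      intro x y hx hy
      obtain ⟨r, hr⟩ := exists_add_pow_prime_eq hp x y
      have : ψ (x + y) - (x + y) ^ (p : ℕ) =
          (ψ x - x ^ (p : ℕ)) + (ψ y - y ^ (p : ℕ)) - (p : ℕ) * (x * y * r) := by
        rw [hr, map_add]; ring
      rw [this]
      exact (hx.add hy).sub (dvd_mul_right _ _)
    induction a using MonoidAlgebra.induction_linear with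
    | zero => simp [hp.ne_zero]
    | add x y hx hy => exact hadd x y hx hy
    | single g c =>
      have h1 : ψ (MonoidAlgebra.single g c) = MonoidAlgebra.single (g ^ (p : ℕ)) c := by
        simp [ψ]
      rw [h1, MonoidAlgebra.single_pow]
      have := Fact.mk hp
      obtain ⟨d, hd⟩ : ((p : ℕ) : ℤ) ∣ c - c ^ (p : ℕ) := by
        rw [← ZMod.intCast_zmod_eq_zero_iff_dvd]
        simp
      refine ⟨MonoidAlgebra.single (g ^ (p : ℕ)) d, ?_⟩
      rw [← MonoidAlgebra.single_sub, hd, ← nsmul_eq_mul, ← nsmul_eq_mul, MonoidAlgebra.smul_single]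

/-- A `λ`-morphism: a ring homomorphism commuting with all `Ψ^n`. -/
def IsLambdaHom {A : Type u} {B : Type v} [CommRing A] [LambdaStructure A] [CommRing B]
    [LambdaStructure B] (φ : A →+* B) : Prop :=
  ∀ (n : ℕ+) (a : A), φ (psi n a) = psi n (φ a)

/-- A `λ`-ideal: an ideal stable under all `Ψ^n`, so that the quotient ring inherits the `Ψ^n`. -/
def IsLambdaIdeal {A : Type u} [CommRing A] [LambdaStructure A] (I : Ideal A) : Prop :=
  ∀ n : ℕ+, I ≤ I.comap (psi n)

/-- The `λ`-structure on the quotient by a `λ`-ideal `I`: `Ψ^n (a + I) = Ψ^n a + I`. -/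
@[reducible]
def IsLambdaIdeal.lambdaStructure {A : Type u} [CommRing A] [LambdaStructure A] {I : Ideal A}
    (hI : IsLambdaIdeal I) : LambdaStructure (A ⧸ I) where
  psi :=
    { toFun := fun n => Ideal.quotientMap I (psi n) (hI n)
      map_one' := Ideal.Quotient.ringHom_ext (RingHom.ext fun a => by simp)
      map_mul' := fun m n => Ideal.Quotient.ringHom_ext (RingHom.ext fun a => by simp) }
  frobenius_lift := fun p hp a => by
    obtain ⟨a, rfl⟩ := Ideal.Quotient.mk_surjective a
    obtain ⟨d, hd⟩ := frobenius_lift p hp a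
    refine ⟨Ideal.Quotient.mk I d, ?_⟩
    have h := congrArg (Ideal.Quotient.mk I) hd
    rw [map_mul, map_sub, map_pow, map_natCast] at h
    exact h

open scoped TensorProduct in
/-- `A` is étale over `𝔽₁`: a nonzero `λ`-ring which is finite projective as a `ℤ`-module and such
that `ℚ ⊗ A` is an étale `ℚ`-algebra. -/
structure IsEtaleOverF1 (A : Type u) [CommRing A] [LambdaStructure A] : Prop where
  nontrivial : Nontrivial A
  finite : Module.Finite ℤ A
  projective : Module.Projective ℤ A
  etale : Algebra.Etale ℚ (ℚ ⊗[ℤ] A)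

/-- The maximal `λ`-spectrum: kernels of surjective `λ`-morphisms to rings étale over `𝔽₁`. -/
def maxLambda (R : Type u) [CommRing R] [LambdaStructure R] : Set (Ideal R) :=
  {I | ∃ (A : Type u) (_ : CommRing A) (_ : LambdaStructure A) (φ : R →+* A),
    IsEtaleOverF1 A ∧ IsLambdaHom φ ∧ Function.Surjective φ ∧ RingHom.ker φ = I}

/-- The set of cyclotomic points: kernels of surjective `λ`-morphisms to the integral group rings
`ℤ[μ_n]` of the groups `μ_n` of `n`-th roots of unity, `n ≥ 1`. -/
def maxCycl (R : Type u) [CommRing R] [LambdaStructure R] : Set (Ideal R) :=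
  {I | ∃ (n : ℕ+) (φ : R →+* MonoidAlgebra ℤ (rootsOfUnity n ℂ)),
    IsLambdaHom φ ∧ Function.Surjective φ ∧ RingHom.ker φ = I}

/-!
All identities between `Ψ^n` and `V_m` on `w(R)` are checked on ghost components over a torsion-free
ring covering `R` (`exists_lift`): `Ψ^n` replaces `γ_k` by `γ_{nk}`, and `V_n` replaces `γ_k` by
`n γ_{k/n}`, or by `0` if `n ∤ k`. In particular `Ψ^n V_n = [n]`, so that for a `λ`-ideal `I` with
torsion-free quotient `V_n s ∈ I` forces `n s ∈ I` and then `s ∈ I`.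

The vanishing of a quotient `A = w(R)/I` that is finite over `ℤ` is an instance of the slenderness
of `ℤ` (`exists_map_eq_zero`): an additive map from `w(R)` to a finitely generated free abelian group
must kill some `V_n(1) = 1/(1 - t^n)`. Otherwise there are positive integers `c_1 ∣ c_2 ∣ ⋯` such
that the image of `c_n V_n(1)` is never divisible by `c_{n+1}` in `A`; then the infinite sums of the
`c_n V_n(1)`, over the uncountably many sets of indices `n`, all have different images in the
countable group `A`. Once `V_n(1)` is in `I`, so is `1`, whence `A = 0`. Applied to the kernels of
surjective `λ`-morphisms, this shows that `w(R)` has no étale or cyclotomic points.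
-/

namespace Witty

/-! ### Ghost components of the Verschiebung -/

section Verschiebung

variable {R : Type u} [CommRing R] {S : Type v} [CommRing S]

theorem ser_verschiebung (n : ℕ+) (u : Witty R) :
    (verschiebung n u).ser = expand n n.ne_zero u.ser := rfl

theorem mapAdd_verschiebung (φ : R →+* S) (n : ℕ+) (u : Witty R) :
    mapAdd φ (verschiebung n u) = verschiebung n (mapAdd φ u) :=
  Witty.ext (map_expand _ _ _ _)

theorem verschiebung_verschiebung_comm (m n : ℕ+) (u : Witty R) :
    verschiebung m (verschiebung n u) = verschiebung n (verschiebung m u) := by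
  refine Witty.ext ?_
  simp only [ser_verschiebung, ← expand_mul]
  simp only [mul_comm]

theorem verschiebung_one (n : ℕ+) : verschiebung n (1 : Witty R) = geom n 1 := by
  refine Witty.ext (PowerSeries.ext fun k => ?_)
  rw [ser_verschiebung, coeff_expand, coeff_geom, one_def]
  simp [coeff_geom]

theorem coeff_X_mul_derivative (f : R⟦X⟧) (k : ℕ) :
    coeff k (X * derivative R f) = (k : R) * coeff k f := by
  cases k with
  | zero => simp
  | succ k => rw [coeff_succ_X_mul, coeff_derivative, mul_comm, Nat.cast_succ]

theorem dlog_verschiebung (n : ℕ+) (u : Witty R) :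
    dlog (verschiebung n u) = (n : R⟦X⟧) * expand n n.ne_zero (dlog u) := by
  have hd : X * derivative R (verschiebung n u).ser =
      (n : R⟦X⟧) * expand n n.ne_zero (X * derivative R u.ser) := by
    refine PowerSeries.ext fun k => ?_
    rw [coeff_X_mul_derivative, ser_verschiebung, ← map_natCast (C : R →+* R⟦X⟧) (n : ℕ),
      coeff_C_mul, coeff_expand, coeff_expand, coeff_X_mul_derivative]
    split_ifs with h
    · obtain ⟨q, rfl⟩ := h
      rw [Nat.mul_div_cancel_left _ n.pos, Nat.cast_mul, mul_assoc]
    · simp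
  have h : (verschiebung n u).ser * dlog (verschiebung n u) =
      (verschiebung n u).ser * ((n : R⟦X⟧) * expand n n.ne_zero (dlog u)) := by
    rw [ser_mul_dlog, hd, ← ser_mul_dlog, map_mul, ser_verschiebung]
    ring
  have h1 := ser_neg_mul (verschiebung n u)
  linear_combination (-verschiebung n u).ser * h
    - (dlog (verschiebung n u) - (n : R⟦X⟧) * expand n n.ne_zero (dlog u)) * h1

theorem ghost_verschiebung (n : ℕ+) (u : Witty R) (k : ℕ) :
    ghost k (verschiebung n u) = if (n : ℕ) ∣ k then (n : R) * ghost (k / n) u else 0 := by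
  rw [ghost_def, ghost_def, dlog_verschiebung, ← map_natCast (C : R →+* R⟦X⟧) (n : ℕ),
    coeff_C_mul, coeff_expand, mul_ite, mul_zero]

theorem psi_apply (n : ℕ+) (u : Witty R) : psi n u = frob n u := rfl

theorem psi_verschiebung (n : ℕ+) (u : Witty R) : psi n (verschiebung n u) = (n : ℕ) • u := by
  obtain ⟨B, _, _, φ, h⟩ := exists_lift R
  obtain ⟨u, rfl⟩ := h u
  rw [psi_apply, ← mapAdd_verschiebung, ← mapAdd_frob, ← map_nsmul]
  refine congrArg _ (ghost_injective fun k => ?_)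
  rw [ghost_frob n.ne_zero, ghost_verschiebung, if_pos (dvd_mul_right _ _),
    Nat.mul_div_cancel_left _ n.pos, map_nsmul, nsmul_eq_mul]

theorem psi_verschiebung_of_coprime {m n : ℕ+} (hmn : Nat.Coprime m n) (u : Witty R) :
    psi m (verschiebung n u) = verschiebung n (psi m u) := by
  obtain ⟨B, _, _, φ, h⟩ := exists_lift R
  obtain ⟨u, rfl⟩ := h u
  rw [psi_apply, psi_apply, ← mapAdd_verschiebung, ← mapAdd_frob, ← mapAdd_frob,
    ← mapAdd_verschiebung]
  refine congrArg _ (ghost_injective fun k => ?_)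
  rw [ghost_frob m.ne_zero, ghost_verschiebung, ghost_verschiebung, ghost_frob m.ne_zero]
  simp only [hmn.symm.dvd_mul_left]
  split_ifs with h
  · rw [Nat.mul_div_assoc _ h]
  · rfl

end Verschiebung

/-! ### Slenderness -/

section Slender

variable {R : Type u} [CommRing R]

theorem infSum_eq_sum_add_nsmul {f g : ℕ → Witty R} (hf : ∀ i, f i ∈ Fil i)
    (hg : ∀ i, g i ∈ Fil i) {N M : ℕ} (h : ∀ i, N ≤ i → f i = M • g i) :
    ∃ y, infSum 1 f = ∑ i ∈ Finset.range N, f i + M • y := by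
  refine ⟨infSum 1 g - ∑ i ∈ Finset.range N, g i, eq_of_sub_mem_fil fun k => ?_⟩
  have hK : 1 * k < max N (k + 1) := by omega
  have h1 := infSum_sub_sum_mem (fun k i hi => fil_mono (by omega) (hf i)) hK
  have h2 := infSum_sub_sum_mem (fun k i hi => fil_mono (by omega) (hg i)) hK
  have h3 : ∑ i ∈ Finset.Ico N (max N (k + 1)), f i =
      M • ∑ i ∈ Finset.Ico N (max N (k + 1)), g i := by
    rw [Finset.smul_sum]
    exact Finset.sum_congr rfl fun i hi => h i (Finset.mem_Ico.1 hi).1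
  rw [← Finset.sum_range_add_sum_Ico _ (le_max_left N (k + 1))] at h1 h2
  rw [h3] at h1
  convert sub_mem h1 (AddSubgroup.nsmul_mem _ h2 M) using 1
  simp only [smul_sub, smul_add]
  abel

/-- A countable torsion-free group in which no nonzero element is divisible by all positive integers
is slender, for sequences tending to `0` in the `t`-adic topology of `w(R)`. -/
theorem exists_map_eq_zero {A : Type v} [AddCommGroup A] [Countable A] [IsAddTorsionFree A]
    (hA : ∀ a : A, a ≠ 0 → ∃ m : ℕ, m ≠ 0 ∧ ∀ b : A, a ≠ m • b)
    (f : Witty R →+ A) {e : ℕ → Witty R} (he : ∀ i, e i ∈ Fil i) : ∃ i, f (e i) = 0 := by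
  by_contra! hne
  choose m hm0 hm using fun i => hA _ (hne i)
  let c : ℕ → ℕ := fun n => ∏ i ∈ Finset.range n, m i
  have hc0 : ∀ n, c n ≠ 0 := fun n => Finset.prod_ne_zero_iff.2 fun i _ => hm0 i
  have hcdvd : ∀ {k n}, k ≤ n → c k ∣ c n := fun h =>
    Finset.prod_dvd_prod_of_subset _ _ _ (Finset.range_subset_range.2 h)
  classical
  let s : Set ℕ → ℕ → Witty R := fun S i => if i ∈ S then c i • e i else 0
  have hs : ∀ S i, s S i ∈ Fil i := fun S i => by
    by_cases h : i ∈ S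
    · simpa only [s, if_pos h] using AddSubgroup.nsmul_mem _ (he i) _
    · simpa only [s, if_neg h] using zero_mem _
  have htail : ∀ S n, ∃ y, infSum 1 (s S) = ∑ i ∈ Finset.range n, s S i + c n • y := by
    intro S n
    refine infSum_eq_sum_add_nsmul (hs S)
      (g := fun i => if i ∈ S then (c i / c n) • e i else 0) (fun i => ?_) fun i hi => ?_
    · split_ifs
      · exact AddSubgroup.nsmul_mem _ (he i) _
      · exact zero_mem _
    · simp only [s, smul_ite, smul_zero, ← mul_smul, Nat.mul_div_cancel' (hcdvd hi)]
  -- the first index at which two sets differ is seen modulo `c (n + 1)`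
  have hsep : ∀ S T n, (∀ i < n, i ∈ S ↔ i ∈ T) → n ∈ S → n ∉ T →
      f (infSum 1 (s S)) ≠ f (infSum 1 (s T)) := by
    intro S T n hlt hS hT heq
    obtain ⟨y, hy⟩ := htail S (n + 1)
    obtain ⟨z, hz⟩ := htail T (n + 1)
    have hsum : ∑ i ∈ Finset.range n, s S i = ∑ i ∈ Finset.range n, s T i :=
      Finset.sum_congr rfl fun i hi => by simp only [s, hlt i (Finset.mem_range.1 hi)]
    have hsS : s S n = c n • e n := if_pos hS
    have hsT : s T n = 0 := if_neg hT
    have hcs : c (n + 1) = c n * m n := Finset.prod_range_succ _ _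
    rw [hy, hz, Finset.sum_range_succ, Finset.sum_range_succ, hsum, hsS, hsT, add_zero, add_assoc,
      map_add f, map_add f, map_add f, add_right_inj, map_nsmul, map_nsmul, map_nsmul, hcs, mul_smul,
      mul_smul, ← smul_add] at heq
    have h := nsmul_right_injective (hc0 n) heq
    exact hm n (f z - f y) (by rw [smul_sub, ← h, add_sub_cancel_right])
  have hinj : Function.Injective fun S => f (infSum 1 (s S)) := by
    intro S T heq
    by_contra hST
    have hex : ∃ n, ¬(n ∈ S ↔ n ∈ T) := by
      by_contra! h
      exact hST (Set.ext h)
    have hlt : ∀ i < Nat.find hex, i ∈ S ↔ i ∈ T := fun i hi => not_not.1 (Nat.find_min hex hi)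
    have hn := Nat.find_spec hex
    by_cases hS : Nat.find hex ∈ S
    · exact hsep S T _ hlt hS (fun hT => hn (iff_of_true hS hT)) heq
    · have hT : Nat.find hex ∈ T := by
        by_contra hT
        exact hn (iff_of_false hS hT)
      exact hsep T S _ (fun i hi => (hlt i hi).symm) hT hS heq.symm
  obtain ⟨g, hg⟩ := exists_injective_nat A
  exact Function.cantor_injective _ (hg.comp hinj)

end Slender

end Witty

theorem Module.exists_ne_nsmul_of_free_int {A : Type v} [AddCommGroup A] [Module.Free ℤ A] {a : A}
    (ha : a ≠ 0) : ∃ m : ℕ, m ≠ 0 ∧ ∀ b : A, a ≠ m • b := by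
  let b := Module.Free.chooseBasis ℤ A
  obtain ⟨i, hi⟩ : ∃ i, b.repr a i ≠ 0 := by
    by_contra! h
    exact ha (b.ext_elem fun i => by rw [h, map_zero, Finsupp.zero_apply])
  refine ⟨(b.repr a i).natAbs + 1, Nat.succ_ne_zero _, fun x hx => ?_⟩
  have h1 : b.repr a i = (((b.repr a i).natAbs + 1 : ℕ) : ℤ) * b.repr x i := by
    conv_lhs => rw [hx]
    rw [map_nsmul, Finsupp.smul_apply, nsmul_eq_mul]
  have h2 := Int.natAbs_dvd_natAbs.2 (Dvd.intro _ h1.symm)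
  rw [Int.natAbs_natCast] at h2
  have := Nat.le_of_dvd (Int.natAbs_pos.2 hi) h2
  omega

namespace Witty

/-! ### Quotients of `w(R)` by `λ`-ideals -/

section Quotient

variable {R : Type u} [CommRing R] {I : Ideal (Witty R)}

theorem mem_of_nsmul_mem [IsAddTorsionFree (Witty R ⧸ I)] {n : ℕ} (hn : n ≠ 0) {s : Witty R}
    (h : n • s ∈ I) : s ∈ I := by
  rw [← Ideal.Quotient.eq_zero_iff_mem] at h ⊢
  rw [map_nsmul] at h
  exact (smul_eq_zero_iff_right hn).1 h

theorem verschiebungQuot_apply (n : ℕ+) (s : Witty R) :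
    verschiebungQuot I n s = Ideal.Quotient.mk I (verschiebung n s) := rfl

theorem psi_mk (hI : IsLambdaIdeal I) (n : ℕ+) (s : Witty R) :
    hI.lambdaStructure.psi n (Ideal.Quotient.mk I s) = Ideal.Quotient.mk I (psi n s) := rfl

theorem mem_of_verschiebung_mem (hI : IsLambdaIdeal I) [IsAddTorsionFree (Witty R ⧸ I)] (n : ℕ+)
    {s : Witty R} (h : verschiebung n s ∈ I) : s ∈ I :=
  mem_of_nsmul_mem n.ne_zero (psi_verschiebung n s ▸ hI n h)

theorem subsingleton_quotient_of_finite (hI : IsLambdaIdeal I) [IsAddTorsionFree (Witty R ⧸ I)]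
    [Module.Finite ℤ (Witty R ⧸ I)] : Subsingleton (Witty R ⧸ I) := by
  have : Countable (Witty R ⧸ I) :=
    (Module.finBasis ℤ (Witty R ⧸ I)).equivFun.toEquiv.injective.countable
  obtain ⟨i, hi⟩ := exists_map_eq_zero (fun _ => Module.exists_ne_nsmul_of_free_int)
    (Ideal.Quotient.mk I).toAddMonoidHom
    (fun i => geom_mem_fil (Nat.lt_succ_self i) (1 : R))
  have h1 : verschiebung i.succPNat (1 : Witty R) ∈ I := by
    rw [verschiebung_one]
    exact Ideal.Quotient.eq_zero_iff_mem.1 hi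
  exact Ideal.Quotient.subsingleton_iff.2
    ((Ideal.eq_top_iff_one I).2 (mem_of_verschiebung_mem hI _ h1))

theorem subsingleton_of_surjective {A : Type v} [CommRing A] [LambdaStructure A]
    [Module.Finite ℤ A] [Module.Projective ℤ A] {φ : Witty R →+* A} (hφ : IsLambdaHom φ)
    (hsurj : Function.Surjective φ) : Subsingleton A := by
  have hI : IsLambdaIdeal (RingHom.ker φ) := fun n s hs => by
    rw [Ideal.mem_comap, RingHom.mem_ker, hφ, RingHom.mem_ker.1 hs, map_zero]
  let ε := RingHom.quotientKerEquivOfSurjective hsurj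
  have : IsAddTorsionFree A := Module.isTorsionFree_int_iff_isAddTorsionFree.1 inferInstance
  have : IsAddTorsionFree (Witty R ⧸ RingHom.ker φ) :=
    Function.Injective.isAddTorsionFree ε.toAddEquiv.toAddMonoidHom ε.injective
  have : Module.Finite ℤ (Witty R ⧸ RingHom.ker φ) :=
    Module.Finite.equiv ε.symm.toAddEquiv.toIntLinearEquiv
  have := subsingleton_quotient_of_finite hI
  exact ε.symm.injective.subsingleton

theorem maxLambda_eq_empty (R : Type u) [CommRing R] : maxLambda (Witty R) = ∅ := by
  refine Set.eq_empty_of_forall_notMem fun I ⟨A, _, _, φ, hA, hφ, hsurj, _⟩ => ?_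
  have := hA.finite
  have := hA.projective
  have := subsingleton_of_surjective hφ hsurj
  exact not_nontrivial A hA.nontrivial

theorem maxCycl_eq_empty (R : Type u) [CommRing R] : maxCycl (Witty R) = ∅ := by
  refine Set.eq_empty_of_forall_notMem fun I ⟨n, φ, hφ, hsurj, _⟩ => ?_
  have := subsingleton_of_surjective hφ hsurj
  exact not_nontrivial (MonoidAlgebra ℤ (rootsOfUnity n ℂ)) inferInstance

end Quotient

end Witty

theorem mainTheorem2 :
    (∀ (R : Type u) [CommRing R],
      (∀ (n : ℕ+) (s : Witty R), psi n (Witty.verschiebung n s) = (n : ℕ) • s) ∧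
      (∀ (I : Ideal (Witty R)) (hI : IsLambdaIdeal I), IsAddTorsionFree (Witty R ⧸ I) →
        (∀ p : ℕ+, (p : ℕ).Prime → ∀ d : Witty R → Witty R,
          (∀ s, s ^ (p : ℕ) + (p : ℕ) • d s = psi p s) → ∀ s ∈ I, d s ∈ I) ∧
        (∀ (n : ℕ+) (s : Witty R), Witty.verschiebungQuot I n s = 0 → s ∈ I) ∧
        (∀ (n : ℕ+) (s : Witty R), hI.lambdaStructure.psi n (Witty.verschiebungQuot I n s) =
          (n : ℕ) • Ideal.Quotient.mk I s) ∧
        (∀ (m n : ℕ+) (s : Witty R), Nat.Coprime m n →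
          hI.lambdaStructure.psi m (Witty.verschiebungQuot I n s) =
            Witty.verschiebungQuot I n (psi m s)) ∧
        (∀ (m n : ℕ+) (s : Witty R), Witty.verschiebungQuot I m (Witty.verschiebung n s) =
          Witty.verschiebungQuot I n (Witty.verschiebung m s)) ∧
        (Module.Finite ℤ (Witty R ⧸ I) → Subsingleton (Witty R ⧸ I))) ∧
      maxLambda (Witty R) = ∅ ∧ maxCycl (Witty R) = ∅) ∧
    maxLambda (Witty ℤ) = ∅ ∧ maxCycl (Witty ℤ) = ∅ := by
  refine ⟨fun R _ => ⟨Witty.psi_verschiebung, fun I hI _ => ⟨fun p hp d hd s hs => ?_,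
    fun n s h => Witty.mem_of_verschiebung_mem hI n (Ideal.Quotient.eq_zero_iff_mem.1 h),
    fun n s => ?_, fun m n s h => ?_, fun m n s => ?_,
    fun _ => Witty.subsingleton_quotient_of_finite hI⟩,
    Witty.maxLambda_eq_empty R, Witty.maxCycl_eq_empty R⟩,
    Witty.maxLambda_eq_empty ℤ, Witty.maxCycl_eq_empty ℤ⟩
  · refine Witty.mem_of_nsmul_mem hp.ne_zero ?_
    rw [← (I.add_mem_iff_right (I.pow_mem_of_mem hs _ hp.pos)), hd]
    exact hI p hs
  · rw [Witty.verschiebungQuot_apply, Witty.psi_mk, Witty.psi_verschiebung, map_nsmul]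
  · rw [Witty.verschiebungQuot_apply, Witty.psi_mk, Witty.psi_verschiebung_of_coprime h]
    rfl
  · rw [Witty.verschiebungQuot_apply, Witty.verschiebungQuot_apply,
      Witty.verschiebung_verschiebung_comm]
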